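/- Let $(X,C)$ be a random pair, where $X$ takes values in a measurable space $\mathcal X$ and $C$ in the finite set of classes $\{1,\dots,M\}$, and let $(x_1,c_1),(x_2,c_2),\dots$ be i.i.d. copies of $(X,C)$. Let $f:\mathcal X\to\mathcal S^{d_z-1}\subset\mathbb R^{d_z}$ be a measurable encoder with values in the Euclidean unit sphere, and put $Z=f(X)$, $z_j=f(x_j)$. Let $d$ be a metric on $\mathbb R^{d_z}$ that on $\mathcal S^{d_z-1}$ is comparable with the Euclidean distance: $a\|u-v\|\le d(u,v)\le b\|u-v\|$ for all $u,v\in\mathcal S^{d_z-1}$, with constants $a,b>0$ (for example any norm distance). Let $K:[0,\infty)\to[0,\infty)$ vanish on $(1,\infty)$ and be strictly decreasing, Lipschitz continuous and differentiable on $[0,1]$ (one-sidedly at the end points), with $-K'(t)>\theta$ for all $t\in[0,1]$ and some $\theta>0$; put $K_h(t)=\frac1h K(\frac th)$. Fix a class $c$ with $\Pr(C=c)>0$ and define, for $N\ge1$, $h>0$, $$\mathsf{NW}_{h,N}(c;u)=\frac{\sum_{j=1}^N K_h(d(u,z_j))\,\mathbf 1\{c_j=c\}}{\sum_{j=1}^N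 K_h(d(u,z_j))},\qquad \hat f_{h,N}(c)=\frac{\sum_{j=1}^N \mathsf{NW}_{h,N}(c;z_j)\,z_j}{\sum_{j=1}^N \mathsf{NW}_{h,N}(c;z_j)},\qquad \bar f(c)=\mathbb E[f(X)\mid C=c],$$ a quotient $0/0$ being read as $0$. Let $h_N>0$ with $h_N\to0$ and $\sqrt{\ln N/(h_N^{d_z}N)}\to0$ as $N\to\infty$. Assume: 1. (Hölder condition) At least one of the following holds: (a) almost surely there are $\beta>0$ and $L<\infty$ such that, for all sufficiently large $N$, $|\mathsf{NW}_{h_N,N}(c;u)-\mathsf{NW}_{h_N,N}(c;v)|\le L\,d(u,v)^\beta$ for all $u,v\in\mathcal S^{d_z-1}$; or (b) there are $\beta>0$, $L<\infty$ and a version $g$ of the soft label $z\mapsto p(c\mid z)=\Pr(C=c\mid Z=z)$ such that $|g(u)-g(v)|\le L\,d(u,v)^\beta$ for all $u,v\in\mathcal S^{d_z-1}$. 2. (Density condition) The law of $Z$ has a density $p_z$ with respect to the Lebesgue (surface) measure on $\mathcal S^{d_z-1}$, and $p_z\ge\kappa$ almost everywhere for some $\kappa>0$. Then, almost surely, $\hat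 f_{h_N,N}(c)\to\bar f(c)$ as $N\to\infty$. -/

import Mathlib

open MeasureTheory ProbabilityTheory Filter Topology

noncomputable section

namespace SoftLabel

/-- Euclidean space `ℝ^m`. -/
abbrev Euc (m : ℕ) : Type := EuclideanSpace ℝ (Fin m)

/-- The unit sphere of `ℝ^m`. -/
abbrev Sph (m : ℕ) : Type := Metric.sphere (0 : Euc m) 1

/-- The Lebesgue (surface) measure on the unit sphere of `ℝ^m`. -/
def surfaceMeasure (m : ℕ) : Measure (Sph m) := (volume : Measure (Euc m)).toSphere

/-- `d` is a metric on the set `E` (nonnegativity follows). -/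
structure IsMetric {E : Type*} (d : E → E → ℝ) : Prop where
  eq_zero_iff : ∀ u v, d u v = 0 ↔ u = v
  symm : ∀ u v, d u v = d v u
  triangle : ∀ u v w, d u w ≤ d u v + d v w

/-- On the unit sphere, `d` is comparable with the Euclidean distance. -/
def ComparableOnSphere {m : ℕ} (d : Euc m → Euc m → ℝ) : Prop :=
  ∃ a b : ℝ, 0 < a ∧ 0 < b ∧
    ∀ u v : Sph m, a * ‖(u : Euc m) - v‖ ≤ d u v ∧ d u v ≤ b * ‖(u : Euc m) - v‖

/-- `K` is a kernel with support `[0,1]`, strictly decreasing and Lipschitz there, whose derivative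
is bounded away from `0`. Only the values of `K` on `[0,∞)` matter, since `K` is applied to
(rescaled) distances; the derivative is the one-sided one at the end points of `[0,1]`. -/
structure IsKernel (K : ℝ → ℝ) : Prop where
  nonneg : ∀ t, 0 ≤ t → 0 ≤ K t
  support : ∀ t, 1 < t → K t = 0
  strictAnti : StrictAntiOn K (Set.Icc 0 1)
  lipschitz : ∃ L, LipschitzOnWith L K (Set.Icc 0 1)
  differentiable : DifferentiableOn ℝ K (Set.Icc 0 1)
  deriv_bound : ∃ θ : ℝ, 0 < θ ∧ ∀ t ∈ Set.Icc (0 : ℝ) 1, θ < -derivWithin K (Set.Icc 0 1) t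

/-- The rescaled kernel `K_h(t) = (1/h) K(t/h)`. -/
def scaledKernel (K : ℝ → ℝ) (h t : ℝ) : ℝ := 1 / h * K (t / h)

/-- The Nadaraya–Watson estimate at `u` of the probability of the class `c`, from the first `N` of
the data points `z j` with labels `y j`. -/
def nadarayaWatson {E : Type*} {M : ℕ} (K : ℝ → ℝ) (d : E → E → ℝ) (h : ℝ) (N : ℕ)
    (z : ℕ → E) (y : ℕ → Fin M) (c : Fin M) (u : E) : ℝ :=
  (∑ j ∈ Finset.range N, scaledKernel K h (d u (z j)) * (if y j = c then 1 else 0)) /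
    ∑ j ∈ Finset.range N, scaledKernel K h (d u (z j))

/-- The kernel estimate `f̂(c)` of the class mean from the first `N` embedded data points. -/
def fHat {m M : ℕ} (K : ℝ → ℝ) (d : Euc m → Euc m → ℝ) (h : ℝ) (N : ℕ)
    (z : ℕ → Euc m) (y : ℕ → Fin M) (c : Fin M) : Euc m :=
  (∑ j ∈ Finset.range N, nadarayaWatson K d h N z y c (z j))⁻¹ •
    ∑ j ∈ Finset.range N, nadarayaWatson K d h N z y c (z j) • z j

variable {𝓧 : Type*} [MeasurableSpace 𝓧]

/-- `f̄(c) = E[f(X) | C = c]`, where `ν` is the joint law of `(X, C)`. -/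
def fBar {m M : ℕ} (ν : Measure (𝓧 × Fin M)) (f : 𝓧 → Sph m) (c : Fin M) : Euc m :=
  ∫ p, (f p.1 : Euc m) ∂(ProbabilityTheory.cond ν (Prod.snd ⁻¹' {c}))

/-- The law of the embedding `Z = f(X)`. -/
def embeddingLaw {m M : ℕ} (ν : Measure (𝓧 × Fin M)) (f : 𝓧 → Sph m) : Measure (Sph m) :=
  ν.map fun p => f p.1

/-- The embedding has a density with respect to the surface measure that is bounded below by a
positive constant. -/
def DensityBoundedBelow {m M : ℕ} (ν : Measure (𝓧 × Fin M)) (f : 𝓧 → Sph m) : Prop :=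
  embeddingLaw ν f ≪ surfaceMeasure m ∧
    ∃ κ : ℝ, 0 < κ ∧ ∀ᵐ z ∂surfaceMeasure m,
      ENNReal.ofReal κ ≤ (embeddingLaw ν f).rnDeriv (surfaceMeasure m) z

/-- `g` is a version of the soft label `z ↦ p(c | z) = P(C = c | Z = z)`, where `Z = f(X)`. -/
def IsSoftLabel {m M : ℕ} (ν : Measure (𝓧 × Fin M)) (f : 𝓧 → Sph m) (c : Fin M)
    (g : Sph m → ℝ) : Prop :=
  Measurable g ∧
    (fun p => g (f p.1)) =ᵐ[ν]
      ν⟦Prod.snd ⁻¹' {c} | MeasurableSpace.comap (fun p => f p.1) inferInstance⟧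

/-- `|g(u) - g(v)| ≤ C d(u,v)^β` for all `u, v` in the unit sphere. -/
def HolderOnSphere {m : ℕ} (d : Euc m → Euc m → ℝ) (C β : ℝ) (g : Sph m → ℝ) : Prop :=
  ∀ u v : Sph m, |g u - g v| ≤ C * d u v ^ β

end SoftLabel

end

/-! Almost sure consistency of the kernel estimate of a class mean. The average over the design
points of the Nadaraya–Watson estimates is rewritten as a weighted sum of the responses. By a form of
Stone's lemma the weights are bounded, so the noise part vanishes by a conditional Hoeffding bound,
and the regression function may be replaced by a continuous approximation in mean. The argument is
universal: it uses neither smoothness of the soft label, nor a density, nor a lower bound on the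
bandwidths. -/

/-! Numerator and denominator of the estimate are both averages over `j` of `φ(z_j)` times the
Nadaraya–Watson value at `z_j`, with `φ` a coordinate function or `1`. It suffices that each such
average tends almost surely to the mean of `1{C = c} φ(Z)`; the class mean is then a quotient of two
limits, the lower one being the probability of `c`, which is nonzero.

Exchanging the two sums turns the average into one of `y_i W_i`, where `y_i` is the class indicator
and `W_i` depends on the design points alone. A packing argument bounds every `W_i` by one constant
(`sum_div_sum_le_of_cells`, `exists_isLocalKernel`). Let `g` be the regression function of `y` and
`γ` a continuous function close to `g` in L¹. Then `y = (y - g) + (g - γ) + γ`. Given the design,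
the first part is centered noise with bounded coefficients, so it vanishes by exponential bounds and
Borel–Cantelli (`ae_tendsto_average_zero`). The second costs at most a constant times the empirical
L¹ distance of `g` and `γ`. On the third, smoothing acts almost as the identity because `γ` is
uniformly continuous, and the law of large numbers applies. -/

namespace KernelRegression

/-! ### Centered noise with weights depending on the whole design. -/

section Resampling

variable {E F : Type*} [MeasurableSpace E] [MeasurableSpace F]

/-- Replacing one coordinate of an i.i.d. sequence by an independent copy preserves its law. -/
lemma measurePreserving_update (ρ : Measure E) [IsProbabilityMeasure ρ] (k : ℕ) :
    MeasurePreserving (fun x : (ℕ → E) × E => Function.update x.1 k x.2)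
      ((Measure.infinitePi fun _ : ℕ => ρ).prod ρ) (Measure.infinitePi fun _ : ℕ => ρ) := by
  have hmeas : Measurable (fun x : (ℕ → E) × E => Function.update x.1 k x.2) :=
    measurable_update'
  refine ⟨hmeas, Measure.eq_infinitePi _ fun s t ht => ?_⟩
  rw [Measure.map_apply hmeas (.pi s.countable_toSet fun i _ => ht i)]
  by_cases hk : k ∈ s
  · have : (fun x : (ℕ → E) × E => Function.update x.1 k x.2) ⁻¹' (Set.pi s t)
        = (Set.pi (s.erase k) t) ×ˢ t k := by
      ext x
      simp only [Set.mem_preimage, Set.mem_pi, Set.mem_prod, Finset.mem_coe, Finset.mem_erase]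
      constructor
      · intro h
        refine ⟨fun i hi => ?_, ?_⟩
        · simpa [hi.1] using h i hi.2
        · simpa using h k hk
      · rintro ⟨h1, h2⟩ i hi
        rcases eq_or_ne i k with rfl | hik
        · simpa using h2
        · simpa [hik] using h1 i ⟨hik, hi⟩
    rw [this, Measure.prod_prod, Measure.infinitePi_pi _ fun i _ => ht i,
      Finset.prod_erase_mul _ _ hk]
  · have : (fun x : (ℕ → E) × E => Function.update x.1 k x.2) ⁻¹' (Set.pi s t)
        = (Set.pi s t) ×ˢ Set.univ := by
      ext x
      simp only [Set.mem_preimage, Set.mem_pi, Set.mem_prod, Finset.mem_coe, Set.mem_univ,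
        and_true]
      refine forall₂_congr fun i hi => ?_
      rw [Function.update_of_ne (ne_of_mem_of_not_mem hi hk)]
    rw [this, Measure.prod_prod, Measure.infinitePi_pi _ fun i _ => ht i, measure_univ, mul_one]

/-- `ξ` has conditional mean zero given the first coordinate. -/
def CondCentered (ρ : Measure (E × F)) (ξ : E × F → ℝ) : Prop :=
  ∀ H : E → ℝ, Measurable H → (∃ B, ∀ u, |H u| ≤ B) → ∫ q, ξ q * H q.1 ∂ρ = 0

variable {ρ : Measure (E × F)} [IsProbabilityMeasure ρ] {ξ : E × F → ℝ}

/-- Fubini over a resampled `k`-th coordinate: with the others frozen, `H` depends on the new pair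
only through its first component, so conditional centering applies. `H` may still involve every
design point, including the `k`-th. -/
lemma integral_mul_eq_zero_of_condCentered (hξ : Measurable ξ) (hξ1 : ∀ q, |ξ q| ≤ 1)
    (hc : CondCentered ρ ξ) (k : ℕ) {H : (ℕ → E × F) → ℝ} (hH : Measurable H)
    {B : ℝ} (hB : ∀ p, |H p| ≤ B)
    (hinv : ∀ p q q', q.1 = q'.1 → H (Function.update p k q) = H (Function.update p k q')) :
    ∫ p, ξ (p k) * H p ∂(Measure.infinitePi fun _ : ℕ => ρ) = 0 := by
  have hmp := measurePreserving_update ρ k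
  have hm : Measurable fun p : ℕ → E × F => ξ (p k) * H p := by fun_prop
  rw [← hmp.map_eq, integral_map hmp.measurable.aemeasurable hm.aestronglyMeasurable,
    integral_prod]
  · refine integral_eq_zero_of_ae (ae_of_all _ fun p => ?_)
    -- The second component of `q₀` is a filler; by `hinv` its value is immaterial.
    obtain ⟨q₀⟩ : Nonempty (E × F) := ⟨p 0⟩
    have := hc (fun u => H (Function.update p k (u, q₀.2)))
      (hH.comp ((measurable_update p).comp (by fun_prop))) ⟨B, fun u => hB _⟩
    simp only [Function.update_self, Pi.zero_apply]
    rw [← this]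
    refine integral_congr_ae (ae_of_all _ fun q => ?_)
    simp only
    rw [hinv p q (q.1, q₀.2) rfl]
  · refine Integrable.of_bound (hm.comp hmp.measurable).aestronglyMeasurable (1 * B)
      (ae_of_all _ fun x => ?_)
    rw [Real.norm_eq_abs, abs_mul]
    exact mul_le_mul (hξ1 _) (hB _) (abs_nonneg _) zero_le_one

/-- Convexity of `exp`: `x * w` is the mean of `w` and `-w` with weights `(1 ± x) / 2`. The bound is
affine in `x`, so its second term integrates to zero against centered noise. -/
lemma exp_mul_le_cosh_add_mul_sinh {x w : ℝ} (hx : |x| ≤ 1) :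
    Real.exp (x * w) ≤ Real.cosh w + x * Real.sinh w := by
  obtain ⟨h1, h2⟩ := abs_le.1 hx
  have := convexOn_exp.2 (Set.mem_univ w) (Set.mem_univ (-w))
    (by linarith : 0 ≤ (1 + x) / 2) (by linarith : 0 ≤ (1 - x) / 2) (by ring)
  simp only [smul_eq_mul] at this
  rw [Real.cosh_eq, Real.sinh_eq]
  calc Real.exp (x * w) = Real.exp ((1 + x) / 2 * w + (1 - x) / 2 * -w) := by ring_nf
    _ ≤ _ := this
    _ = _ := by ring

/-- A Hoeffding bound: conditionally centered noise with bounded weights that may depend on all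
the design points. -/
lemma integral_exp_sum_le (hξ : Measurable ξ) (hξ1 : ∀ q, |ξ q| ≤ 1) (hc : CondCentered ρ ξ)
    {W : ℕ → (ℕ → E) → ℝ} (hW : ∀ i, Measurable (W i)) {B : ℝ} (hB : ∀ i z, |W i z| ≤ B) (n : ℕ) :
    ∫ p, Real.exp (∑ i ∈ Finset.range n, ξ (p i) * W i fun j => (p j).1)
      ∂(Measure.infinitePi fun _ : ℕ => ρ) ≤ Real.exp (B ^ 2 / 2) ^ n := by
  set μ := Measure.infinitePi fun _ : ℕ => ρ
  have hWm : ∀ i, Measurable fun p : ℕ → E × F => W i fun j => (p j).1 := fun i =>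
    (hW i).comp (by fun_prop)
  induction n with
  | zero => simp
  | succ n ih =>
    set G : (ℕ → E × F) → ℝ := fun p =>
      Real.exp (∑ i ∈ Finset.range n, ξ (p i) * W i fun j => (p j).1) with hG
    have hGm : Measurable G := by fun_prop
    have hG0 : ∀ p, 0 ≤ G p := fun p => (Real.exp_pos _).le
    have hterm : ∀ i (p : ℕ → E × F), |ξ (p i) * W i fun j => (p j).1| ≤ B := fun i p => by
      rw [abs_mul]
      simpa using mul_le_mul (hξ1 (p i)) (hB i _) (abs_nonneg _) zero_le_one
    have hGb : ∀ p, G p ≤ Real.exp (n * B) := fun p => by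
      refine Real.exp_le_exp.2 ((Finset.sum_le_sum fun i _ => (abs_le.1 (hterm i p)).2).trans ?_)
      simp
    have hsinh : ∀ p : ℕ → E × F, |Real.sinh (W n fun j => (p j).1)| ≤ Real.sinh B := fun p => by
      rw [Real.abs_sinh]
      exact Real.sinh_le_sinh.2 (hB n _)
    have hHm : Measurable fun p : ℕ → E × F => Real.sinh (W n fun j => (p j).1) * G p :=
      (Real.continuous_sinh.measurable.comp (hWm n)).mul hGm
    have hHb : ∀ p : ℕ → E × F, |Real.sinh (W n fun j => (p j).1) * G p|
        ≤ Real.sinh B * Real.exp (n * B) := fun p => by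
      rw [abs_mul, abs_of_nonneg (hG0 p)]
      exact mul_le_mul (hsinh p) (hGb p) (hG0 p) ((abs_nonneg _).trans (hsinh p))
    -- Changing only the label of the `n`-th pair alters neither the weights nor the noise terms
    -- with index below `n`.
    have horth := integral_mul_eq_zero_of_condCentered hξ hξ1 hc n hHm hHb fun p q q' hq => by
      have h1 : (fun j => (Function.update p n q j).1) = fun j => (Function.update p n q' j).1 := by
        ext j
        rcases eq_or_ne j n with rfl | hj
        · simpa using hq
        · simp [hj]
      simp only [hG, h1]
      congr 2
      refine Finset.sum_congr rfl fun i hi => ?_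
      have : i ≠ n := (Finset.mem_range.1 hi).ne
      simp [this]
    have hGint : Integrable G μ := Integrable.of_bound hGm.aestronglyMeasurable (Real.exp (n * B))
      (ae_of_all _ fun p => by rw [Real.norm_eq_abs, abs_of_nonneg (hG0 p)]; exact hGb p)
    have hHint : Integrable
        (fun p : ℕ → E × F => ξ (p n) * (Real.sinh (W n fun j => (p j).1) * G p)) μ :=
      Integrable.of_bound (by fun_prop) (1 * (Real.sinh B * Real.exp (n * B)))
        (ae_of_all _ fun p => by
          rw [Real.norm_eq_abs, abs_mul]
          exact mul_le_mul (hξ1 _) (hHb p) (abs_nonneg _) zero_le_one)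
    have hpt : ∀ p : ℕ → E × F,
        Real.exp (∑ i ∈ Finset.range (n + 1), ξ (p i) * W i fun j => (p j).1)
        ≤ Real.exp (B ^ 2 / 2) * G p
          + ξ (p n) * (Real.sinh (W n fun j => (p j).1) * G p) := fun p => by
      rw [Finset.sum_range_succ, Real.exp_add]
      change G p * _ ≤ _
      have h1 := exp_mul_le_cosh_add_mul_sinh (w := W n fun j => (p j).1) (hξ1 (p n))
      have h2 : Real.cosh (W n fun j => (p j).1) ≤ Real.exp (B ^ 2 / 2) :=
        (Real.cosh_le_exp_half_sq _).trans (Real.exp_le_exp.2 (by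
          have := sq_le_sq' (by linarith [(abs_le.1 (hB n fun j => (p j).1)).1])
            (abs_le.1 (hB n fun j => (p j).1)).2
          linarith))
      nlinarith [mul_le_mul_of_nonneg_left (h1.trans (add_le_add_left h2 _)) (hG0 p)]
    calc _ ≤ ∫ p, (Real.exp (B ^ 2 / 2) * G p
          + ξ (p n) * (Real.sinh (W n fun j => (p j).1) * G p)) ∂μ :=
        integral_mono_of_nonneg (ae_of_all _ fun p => (Real.exp_pos _).le)
          ((hGint.const_mul _).add hHint) (ae_of_all _ hpt)
      _ = Real.exp (B ^ 2 / 2) * ∫ p, G p ∂μ := by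
        rw [integral_add (hGint.const_mul _) hHint, horth, add_zero, integral_const_mul]
      _ ≤ _ := by
        rw [pow_succ' (Real.exp _)]
        exact mul_le_mul_of_nonneg_left ih (Real.exp_pos _).le

/-- Chernoff's bound makes the exceptional probabilities decay geometrically in `N`; Borel–Cantelli
concludes. -/
lemma ae_eventually_sum_lt (hξ : Measurable ξ) (hξ1 : ∀ q, |ξ q| ≤ 1) (hc : CondCentered ρ ξ)
    {W : ℕ → ℕ → (ℕ → E) → ℝ} (hW : ∀ N i, Measurable (W N i)) {B : ℝ} (hB0 : 0 < B)
    (hB : ∀ N i z, |W N i z| ≤ B) {δ : ℝ} (hδ : 0 < δ) :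
    ∀ᵐ p ∂(Measure.infinitePi fun _ : ℕ => ρ), ∀ᶠ N : ℕ in atTop,
      ∑ i ∈ Finset.range N, ξ (p i) * W N i (fun j => (p j).1) < δ * N := by
  set μ := Measure.infinitePi fun _ : ℕ => ρ
  -- This `s` minimizes the exponent `-s δ + s² B² / 2`; the minimum gives the ratio `r`.
  set s := δ / B ^ 2 with hs
  have hs0 : 0 < s := by positivity
  set r := Real.exp (-(δ ^ 2 / (2 * B ^ 2))) with hr
  have hr1 : r < 1 := by
    rw [hr, Real.exp_lt_one_iff]
    have : 0 < δ ^ 2 / (2 * B ^ 2) := by positivity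
    linarith
  have hWm : ∀ N i, Measurable fun p : ℕ → E × F => W N i fun j => (p j).1 := fun N i =>
    (hW N i).comp (by fun_prop)
  set S : ℕ → (ℕ → E × F) → ℝ := fun N p =>
    ∑ i ∈ Finset.range N, ξ (p i) * W N i (fun j => (p j).1) with hS
  have hSm : ∀ N, Measurable (S N) := fun N => by fun_prop
  have hterm : ∀ N i (p : ℕ → E × F), |ξ (p i) * W N i fun j => (p j).1| ≤ B := fun N i p => by
    rw [abs_mul]
    simpa using mul_le_mul (hξ1 (p i)) (hB N i _) (abs_nonneg _) zero_le_one
  have hSb : ∀ N p, S N p ≤ N * B := fun N p =>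
    (Finset.sum_le_sum fun i _ => (abs_le.1 (hterm N i p)).2).trans (by simp)
  have hbound : ∀ N : ℕ, μ {p | δ * N ≤ S N p} ≤ ENNReal.ofReal r ^ N := fun N => by
    have hint : Integrable (fun p => Real.exp (s * S N p)) μ :=
      Integrable.of_bound (by fun_prop) (Real.exp (s * (N * B))) (ae_of_all _ fun p => by
        rw [Real.norm_eq_abs, abs_of_pos (Real.exp_pos _)]
        exact Real.exp_le_exp.2 (mul_le_mul_of_nonneg_left (hSb N p) hs0.le))
    have h1 := measure_ge_le_exp_mul_mgf (μ := μ) (X := S N) (δ * N) hs0.le hint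
    have h2 : mgf (S N) μ s ≤ Real.exp ((s * B) ^ 2 / 2) ^ N := by
      have := integral_exp_sum_le hξ hξ1 hc (W := fun i z => s * W N i z) (B := s * B)
        (fun i => (hW N i).const_mul s) (fun i z => by
          rw [abs_mul, abs_of_pos hs0]; exact mul_le_mul_of_nonneg_left (hB N i z) hs0.le) N
      refine le_of_eq_of_le ?_ this
      rw [mgf]
      refine integral_congr_ae (ae_of_all _ fun p => ?_)
      simp only [hS, Finset.mul_sum]
      congr 1
      exact Finset.sum_congr rfl fun i _ => by ring
    have h3 : μ.real {p | δ * N ≤ S N p} ≤ r ^ N := by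
      refine h1.trans ((mul_le_mul_of_nonneg_left h2 (Real.exp_pos _).le).trans_eq ?_)
      rw [hr, ← Real.exp_nat_mul, ← Real.exp_nat_mul, ← Real.exp_add]
      congr 1
      rw [hs]
      field_simp
      ring
    rw [← ofReal_measureReal, ← ENNReal.ofReal_pow (Real.exp_pos _).le]
    exact ENNReal.ofReal_le_ofReal h3
  have hsum : ∑' N : ℕ, μ {p | δ * N ≤ S N p} ≠ ⊤ := by
    refine ne_top_of_le_ne_top ?_ (ENNReal.tsum_le_tsum hbound)
    rw [ENNReal.tsum_geometric]
    refine ENNReal.inv_ne_top.2 (tsub_pos_of_lt ?_).ne'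
    rw [← ENNReal.ofReal_one]
    exact (ENNReal.ofReal_lt_ofReal_iff zero_lt_one).2 hr1
  filter_upwards [ae_eventually_notMem hsum] with p hp
  filter_upwards [hp] with N hN
  simpa using hN

/-- Averages of conditionally centered noise with bounded weights tend to zero almost surely. -/
lemma ae_tendsto_average_zero (hξ : Measurable ξ) (hξ1 : ∀ q, |ξ q| ≤ 1) (hc : CondCentered ρ ξ)
    {W : ℕ → ℕ → (ℕ → E) → ℝ} (hW : ∀ N i, Measurable (W N i)) {B : ℝ}
    (hB : ∀ N i z, |W N i z| ≤ B) :
    ∀ᵐ p ∂(Measure.infinitePi fun _ : ℕ => ρ), Tendsto (fun N : ℕ =>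
      (N : ℝ)⁻¹ * ∑ i ∈ Finset.range N, ξ (p i) * W N i (fun j => (p j).1)) atTop (𝓝 0) := by
  -- The maximum with `1` makes the bound strictly positive, as the choice of `s` above requires.
  have hB' : ∀ N i z, |W N i z| ≤ max B 1 := fun N i z => (hB N i z).trans (le_max_left _ _)
  have hB0 : 0 < max B 1 := lt_max_of_lt_right zero_lt_one
  have h1 := ae_all_iff.2 fun n : ℕ => ae_eventually_sum_lt hξ hξ1 hc hW hB0 hB'
    (δ := 1 / ((n : ℝ) + 1)) (by positivity)
  have h2 := ae_all_iff.2 fun n : ℕ => ae_eventually_sum_lt hξ hξ1 hc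
    (W := fun N i z => -W N i z) (fun N i => (hW N i).neg) hB0
    (fun N i z => by rw [abs_neg]; exact hB' N i z) (δ := 1 / ((n : ℝ) + 1)) (by positivity)
  filter_upwards [h1, h2] with p h1 h2
  rw [Metric.tendsto_atTop']
  intro ε hε
  obtain ⟨n, hn⟩ := exists_nat_one_div_lt hε
  obtain ⟨N₀, hN₀⟩ := eventually_atTop.1 ((h1 n).and (h2 n))
  refine ⟨N₀, fun N hN => ?_⟩
  obtain ⟨ha, hb⟩ := hN₀ N hN.le
  simp only [mul_neg, Finset.sum_neg_distrib] at hb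
  have hNpos : (0 : ℝ) < N := by exact_mod_cast (Nat.zero_le _).trans_lt hN
  rw [Real.dist_eq, sub_zero, abs_mul, abs_of_pos (inv_pos.2 hNpos), inv_mul_lt_iff₀ hNpos]
  refine (abs_lt.2 ⟨by linarith, ha⟩).trans_le ?_
  rw [mul_comm]
  exact mul_le_mul_of_nonneg_left hn.le hNpos.le

end Resampling

/-! ### Boundedness of the normalized weights. -/

section Stone

/-- A form of Stone's lemma: if the points interacting with `u` fall into finitely many cells such
that any two points of a cell interact strongly, then the normalized kernel weights of `u` are
bounded independently of the number of points. -/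
lemma sum_div_sum_le_of_cells {E ι : Type*} {k : E → E → ℝ} (hk : ∀ u v, 0 ≤ k u v)
    {u : E} (T : Finset ι) (cell : E → ι) (hcell : ∀ v, k v u ≠ 0 → cell v ∈ T)
    {α β : ℝ} (hα : 0 < α) (hβ : 0 ≤ β) (hle : ∀ v, k v u ≤ β)
    (hge : ∀ v w, k v u ≠ 0 → k w u ≠ 0 → cell v = cell w → α ≤ k v w)
    (n : ℕ) (z : ℕ → E) :
    ∑ j ∈ Finset.range n, k (z j) u / ∑ l ∈ Finset.range n, k (z j) (z l) ≤ T.card * (β / α) := by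
  classical
  set J := (Finset.range n).filter fun j => k (z j) u ≠ 0 with hJ
  have h1 : ∑ j ∈ Finset.range n, k (z j) u / ∑ l ∈ Finset.range n, k (z j) (z l)
      = ∑ j ∈ J, k (z j) u / ∑ l ∈ Finset.range n, k (z j) (z l) := by
    refine (Finset.sum_subset (Finset.filter_subset _ _) fun j hj hj' => ?_).symm
    have : k (z j) u = 0 := by
      by_contra h
      exact hj' (Finset.mem_filter.2 ⟨hj, h⟩)
    rw [this, zero_div]
  have hmaps : ∀ j ∈ J, cell (z j) ∈ T := fun j hj => hcell _ (Finset.mem_filter.1 hj).2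
  rw [h1, ← Finset.sum_fiberwise_of_maps_to hmaps, ← nsmul_eq_mul]
  refine Finset.sum_le_card_nsmul _ _ _ fun t _ => ?_
  set A := J.filter fun j => cell (z j) = t with hA
  rcases A.eq_empty_or_nonempty with hA0 | hA0
  · rw [hA0, Finset.sum_empty]
    positivity
  have hcard : (0 : ℝ) < A.card := by exact_mod_cast hA0.card_pos
  -- Each denominator with `j` in the cell already contains `A.card` terms of size at least `α`.
  -- Summing over `A` cancels the cardinality, so a crowded cell contributes no more than a sparse
  -- one.
  have hterm : ∀ j ∈ A, k (z j) u / ∑ l ∈ Finset.range n, k (z j) (z l) ≤ β / (A.card * α) := by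
    intro j hj
    refine div_le_div₀ hβ (hle _) (by positivity) ?_
    obtain ⟨hjJ, hjt⟩ := Finset.mem_filter.1 hj
    calc (A.card : ℝ) * α = ∑ _l ∈ A, α := by simp
      _ ≤ ∑ l ∈ A, k (z j) (z l) := Finset.sum_le_sum fun l hl => by
          obtain ⟨hlJ, hlt⟩ := Finset.mem_filter.1 hl
          exact hge _ _ (Finset.mem_filter.1 hjJ).2 (Finset.mem_filter.1 hlJ).2
            (hjt.trans hlt.symm)
      _ ≤ _ := Finset.sum_le_sum_of_subset_of_nonneg
          ((Finset.filter_subset _ _).trans (Finset.filter_subset _ _)) fun l _ _ => hk _ _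
  calc _ ≤ ∑ _j ∈ A, β / (A.card * α) := Finset.sum_le_sum hterm
    _ = β / α := by
      rw [Finset.sum_const, nsmul_eq_mul]
      field_simp

end Stone

/-- Kernels `k N`, concentrating at the diagonal as `N` grows, whose normalized weights are bounded
by `C`. -/
structure IsLocalKernel {E : Type*} [MetricSpace E] [MeasurableSpace E] (k : ℕ → E → E → ℝ)
    (C : ℝ) : Prop where
  measurable : ∀ N, Measurable fun x : E × E => k N x.1 x.2
  nonneg : ∀ N u v, 0 ≤ k N u v
  diag_pos : ∀ N u, 0 < k N u u
  concentrating : ∀ δ, 0 < δ → ∀ᶠ N in atTop, ∀ u v, k N u v ≠ 0 → dist u v < δ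
  bound_nonneg : 0 ≤ C
  weights_le : ∀ N n (z : ℕ → E) (u : E),
    ∑ j ∈ Finset.range n, k N (z j) u / ∑ l ∈ Finset.range n, k N (z j) (z l) ≤ C

/-- The total weight that the `i`-th response receives in the `φ`-weighted sum of the
Nadaraya–Watson estimates at the design points. -/
noncomputable def responseWeight {E : Type*} (k : E → E → ℝ) (φ : E → ℝ) (n i : ℕ) (z : ℕ → E) : ℝ :=
  ∑ j ∈ Finset.range n, φ (z j) * (k (z j) (z i) / ∑ l ∈ Finset.range n, k (z j) (z l))

/-! ### Exchange of summation and smoothing estimates. -/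

section Deterministic

variable {E : Type*}

lemma sum_mul_smoother_eq (k : E → E → ℝ) (φ : E → ℝ) (n : ℕ) (z : ℕ → E) (y : ℕ → ℝ) :
    ∑ j ∈ Finset.range n, φ (z j) * ((∑ i ∈ Finset.range n, k (z j) (z i) * y i)
        / ∑ l ∈ Finset.range n, k (z j) (z l))
      = ∑ i ∈ Finset.range n, y i * responseWeight k φ n i z := by
  simp only [responseWeight, Finset.mul_sum, Finset.sum_div]
  rw [Finset.sum_comm]
  exact Finset.sum_congr rfl fun i _ => Finset.sum_congr rfl fun j _ => by ring

variable [MetricSpace E] [MeasurableSpace E] {k : ℕ → E → E → ℝ} {C : ℝ}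

lemma IsLocalKernel.abs_responseWeight_le (hk : IsLocalKernel k C) {φ : E → ℝ}
    (hφ : ∀ u, |φ u| ≤ 1) (N n i : ℕ) (z : ℕ → E) : |responseWeight (k N) φ n i z| ≤ C := by
  refine (Finset.abs_sum_le_sum_abs _ _).trans ((Finset.sum_le_sum fun j _ => ?_).trans
    (hk.weights_le N n z (z i)))
  have h0 : 0 ≤ k N (z j) (z i) / ∑ l ∈ Finset.range n, k N (z j) (z l) :=
    div_nonneg (hk.nonneg _ _ _) (Finset.sum_nonneg fun l _ => hk.nonneg _ _ _)
  rw [abs_mul, abs_of_nonneg h0]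
  exact mul_le_of_le_one_left h0 (hφ _)

lemma IsLocalKernel.measurable_responseWeight (hk : IsLocalKernel k C) {φ : E → ℝ}
    (hφ : Measurable φ) (N n i : ℕ) : Measurable (responseWeight (k N) φ n i) := by
  have h : ∀ j l, Measurable fun z : ℕ → E => k N (z j) (z l) := fun j l =>
    (hk.measurable N).comp (by fun_prop : Measurable fun z : ℕ → E => (z j, z l))
  unfold responseWeight
  refine Finset.measurable_fun_sum _ fun j _ => ?_
  exact (hφ.comp (measurable_pi_apply j)).mul
    ((h j i).div (Finset.measurable_fun_sum _ fun l _ => h j l))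

/-- Smoothing a function that oscillates little at the scale of the kernel changes it little. -/
lemma IsLocalKernel.abs_smoother_sub_le (hk : IsLocalKernel k C) {N : ℕ} {γ : E → ℝ} {η : ℝ}
    (hγ : ∀ u v, k N u v ≠ 0 → |γ v - γ u| ≤ η) {n j : ℕ} (hj : j < n) (z : ℕ → E) :
    |(∑ i ∈ Finset.range n, k N (z j) (z i) * γ (z i))
        / ∑ l ∈ Finset.range n, k N (z j) (z l) - γ (z j)| ≤ η := by
  -- The design point `z j` is itself in the sum, so the quotient is never `0/0`.
  have hS : 0 < ∑ l ∈ Finset.range n, k N (z j) (z l) :=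
    Finset.sum_pos' (fun l _ => hk.nonneg _ _ _) ⟨j, Finset.mem_range.2 hj, hk.diag_pos _ _⟩
  rw [div_sub' hS.ne', abs_div, abs_of_pos hS, div_le_iff₀ hS, Finset.sum_mul,
    ← Finset.sum_sub_distrib, Finset.mul_sum]
  refine (Finset.abs_sum_le_sum_abs _ _).trans (Finset.sum_le_sum fun i _ => ?_)
  rw [← mul_sub, abs_mul, abs_of_nonneg (hk.nonneg _ _ _), mul_comm]
  by_cases h : k N (z j) (z i) = 0
  · simp [h]
  · exact mul_le_mul_of_nonneg_right (hγ _ _ h) (hk.nonneg _ _ _)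

end Deterministic

/-! ### Law of large numbers and regression function. -/

section Limit

lemma ae_tendsto_average {X : Type*} [MeasurableSpace X] (ρ : Measure X) [IsProbabilityMeasure ρ]
    {G : X → ℝ} (hG : Measurable G) {B : ℝ} (hB : ∀ x, |G x| ≤ B) :
    ∀ᵐ p ∂(Measure.infinitePi fun _ : ℕ => ρ),
      Tendsto (fun N : ℕ => (N : ℝ)⁻¹ * ∑ i ∈ Finset.range N, G (p i)) atTop (𝓝 (∫ x, G x ∂ρ)) := by
  have hmp := measurePreserving_eval_infinitePi (fun _ : ℕ => ρ)
  have hind := iIndepFun_infinitePi (P := fun _ : ℕ => ρ) (X := fun _ => G) fun _ => hG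
  have hGi : ∀ i, Measurable fun p : ℕ → X => G (p i) := fun i => hG.comp (measurable_pi_apply i)
  have h := strong_law_ae_real (μ := Measure.infinitePi fun _ : ℕ => ρ) (fun i p => G (p i))
    (Integrable.of_bound (hGi 0).aestronglyMeasurable B (ae_of_all _ fun p => hB _))
    (fun i j hij => hind.indepFun hij) fun i =>
      { aemeasurable_fst := (hGi i).aemeasurable
        aemeasurable_snd := (hGi 0).aemeasurable
        map_eq := by
          rw [← Function.comp_def G, ← Function.comp_def G,
            ← Measure.map_map hG (measurable_pi_apply i),
            ← Measure.map_map hG (measurable_pi_apply 0)]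
          exact congrArg _ ((hmp i).map_eq.trans (hmp 0).map_eq.symm) }
  have hint : ∫ p, G (p 0) ∂(Measure.infinitePi fun _ : ℕ => ρ) = ∫ x, G x ∂ρ := by
    have := integral_map (hmp 0).measurable.aemeasurable
      (hG.aestronglyMeasurable (μ := (Measure.infinitePi fun _ : ℕ => ρ).map (Function.eval 0)))
    rw [(hmp 0).map_eq] at this
    exact this.symm
  filter_upwards [h] with p hp
  rw [hint] at hp
  simpa only [div_eq_inv_mul] using hp

variable {E F : Type*} [MeasurableSpace E] [MeasurableSpace F]

/-- A bounded response has a regression function on the first coordinate. -/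
lemma exists_condCentered [StandardBorelSpace F] [Nonempty F] (ρ : Measure (E × F))
    [IsProbabilityMeasure ρ] {y : F → ℝ} (hy : Measurable y) (hy0 : ∀ l, 0 ≤ y l)
    (hy1 : ∀ l, y l ≤ 1) :
    ∃ g : E → ℝ, Measurable g ∧ (∀ u, 0 ≤ g u) ∧ (∀ u, g u ≤ 1) ∧
      CondCentered ρ fun q => y q.2 - g q.1 := by
  -- Disintegration: `κ u` is the conditional law of the label at `u`, and `g` its mean response.
  obtain ⟨κ, _, hρ⟩ : ∃ κ : Kernel E F, IsMarkovKernel κ ∧ ρ.fst ⊗ₘ κ = ρ :=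
    ⟨ρ.condKernel, inferInstance, ρ.disintegrate ρ.condKernel⟩
  have hyint : ∀ u, Integrable y (κ u) := fun u =>
    Integrable.of_bound hy.aestronglyMeasurable 1 (ae_of_all _ fun l => by
      rw [Real.norm_eq_abs, abs_of_nonneg (hy0 l)]; exact hy1 l)
  have hgm : Measurable fun u => ∫ l, y l ∂(κ u) :=
    (hy.stronglyMeasurable.integral_kernel (κ := κ)).measurable
  have hg0 : ∀ u, 0 ≤ ∫ l, y l ∂(κ u) := fun u => integral_nonneg hy0
  have hg1 : ∀ u, ∫ l, y l ∂(κ u) ≤ 1 := fun u =>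
    (integral_mono (hyint u) (integrable_const 1) hy1).trans (by simp)
  refine ⟨fun u => ∫ l, y l ∂(κ u), hgm, hg0, hg1, fun H hH ⟨B, hB⟩ => ?_⟩
  have hm : Measurable fun q : E × F => (y q.2 - ∫ l, y l ∂(κ q.1)) * H q.1 :=
    ((hy.comp measurable_snd).sub (hgm.comp measurable_fst)).mul (hH.comp measurable_fst)
  have hint : Integrable (fun q : E × F => (y q.2 - ∫ l, y l ∂(κ q.1)) * H q.1) ρ :=
    Integrable.of_bound hm.aestronglyMeasurable (1 * B) (ae_of_all _ fun q => by
      rw [Real.norm_eq_abs, abs_mul]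
      refine mul_le_mul (abs_le.2 ⟨?_, ?_⟩) (hB _) (abs_nonneg _) zero_le_one <;>
      linarith [hy0 q.2, hy1 q.2, hg0 q.1, hg1 q.1])
  rw [← hρ] at hint
  have hcomp := Measure.integral_compProd hint
  rw [hρ] at hcomp
  refine hcomp.trans ?_
  refine integral_eq_zero_of_ae (ae_of_all _ fun u => ?_)
  simp only [Pi.zero_apply]
  rw [integral_mul_const, integral_sub (hyint u) (integrable_const _)]
  simp

end Limit

/-! ### Universal consistency on a compact metric space. -/

section Consistency

variable {E F : Type*} [MetricSpace E] [CompactSpace E] [MeasurableSpace E]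
  [MeasurableSpace F] {k : ℕ → E → E → ℝ} {C : ℝ}

/-- The pathwise error budget: `ε` for noise, `2 * C * ε` for replacing `g` by `γ` (limit `R` plus
fluctuation, times the weight bound), and `ε` each for smoothing `γ`, for the law of large numbers
and for `|J - I|`. -/
lemma IsLocalKernel.eventually_abs_average_sub_le (hk : IsLocalKernel k C) {φ γ g : E → ℝ}
    (hφ : ∀ u, |φ u| ≤ 1) (hγ : Continuous γ) {ε : ℝ} (hε : 0 < ε) {z : ℕ → E} {y : ℕ → ℝ}
    {I J R : ℝ} (hR : R ≤ ε) (hIJ : |J - I| ≤ ε)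
    (h1 : Tendsto (fun N : ℕ => (N : ℝ)⁻¹ * ∑ i ∈ Finset.range N,
      (y i - g (z i)) * responseWeight (k N) φ N i z) atTop (𝓝 0))
    (h2 : Tendsto (fun N : ℕ => (N : ℝ)⁻¹ * ∑ i ∈ Finset.range N, |g (z i) - γ (z i)|)
      atTop (𝓝 R))
    (h3 : Tendsto (fun N : ℕ => (N : ℝ)⁻¹ * ∑ i ∈ Finset.range N, γ (z i) * φ (z i))
      atTop (𝓝 J)) :
    ∀ᶠ N : ℕ in atTop, |(N : ℝ)⁻¹ * (∑ j ∈ Finset.range N, φ (z j) *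
        ((∑ i ∈ Finset.range N, k N (z j) (z i) * y i)
          / ∑ l ∈ Finset.range N, k N (z j) (z l))) - I| ≤ (2 * C + 4) * ε := by
  obtain ⟨δ, hδ, hδγ⟩ := Metric.uniformContinuous_iff.1
    (CompactSpace.uniformContinuous_of_continuous hγ) ε hε
  filter_upwards [hk.concentrating δ hδ, eventually_gt_atTop 0,
    (Metric.tendsto_nhds.1 h1 ε hε), (Metric.tendsto_nhds.1 h2 ε hε),
    (Metric.tendsto_nhds.1 h3 ε hε)] with N hloc hN h1 h2 h3
  have hNpos : (0 : ℝ) < (N : ℝ)⁻¹ := inv_pos.2 (by exact_mod_cast hN)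
  have hosc : ∀ u v, k N u v ≠ 0 → |γ v - γ u| ≤ ε := fun u v huv => by
    rw [← Real.dist_eq, dist_comm]
    exact (hδγ (hloc u v huv)).le
  set W := fun i => responseWeight (k N) φ N i z with hW
  have hWC : ∀ i, |W i| ≤ C := fun i => hk.abs_responseWeight_le hφ N N i z
  have hsplit : ∑ j ∈ Finset.range N, φ (z j) *
        ((∑ i ∈ Finset.range N, k N (z j) (z i) * y i) / ∑ l ∈ Finset.range N, k N (z j) (z l))
      = ∑ i ∈ Finset.range N, (y i - g (z i)) * W i
        + ∑ i ∈ Finset.range N, (g (z i) - γ (z i)) * W i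
        + ∑ j ∈ Finset.range N, φ (z j) * ((∑ i ∈ Finset.range N, k N (z j) (z i) * γ (z i))
          / ∑ l ∈ Finset.range N, k N (z j) (z l) - γ (z j))
        + ∑ i ∈ Finset.range N, γ (z i) * φ (z i) := by
    have := sum_mul_smoother_eq (k N) φ N z fun i => γ (z i)
    simp only [mul_sub, Finset.sum_sub_distrib]
    rw [this, sum_mul_smoother_eq]
    simp only [hW, sub_mul, Finset.sum_sub_distrib, mul_comm (γ _) (φ _)]
    ring
  have hb2 : |(N : ℝ)⁻¹ * ∑ i ∈ Finset.range N, (g (z i) - γ (z i)) * W i| ≤ 2 * C * ε := by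
    rw [abs_mul, abs_of_pos hNpos]
    calc _ ≤ (N : ℝ)⁻¹ * ∑ i ∈ Finset.range N, |g (z i) - γ (z i)| * C := by
          refine mul_le_mul_of_nonneg_left ((Finset.abs_sum_le_sum_abs _ _).trans
            (Finset.sum_le_sum fun i _ => ?_)) hNpos.le
          rw [abs_mul]
          exact mul_le_mul_of_nonneg_left (hWC i) (abs_nonneg _)
      _ = ((N : ℝ)⁻¹ * ∑ i ∈ Finset.range N, |g (z i) - γ (z i)|) * C := by
          rw [← Finset.sum_mul, mul_assoc]
      _ ≤ (2 * ε) * C := mul_le_mul_of_nonneg_right (by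
          rw [Real.dist_eq] at h2
          linarith [(abs_lt.1 h2).2]) hk.bound_nonneg
      _ = _ := by ring
  have hb3 : |(N : ℝ)⁻¹ * ∑ j ∈ Finset.range N, φ (z j) *
      ((∑ i ∈ Finset.range N, k N (z j) (z i) * γ (z i))
          / ∑ l ∈ Finset.range N, k N (z j) (z l) - γ (z j))| ≤ ε := by
    rw [abs_mul, abs_of_pos hNpos, inv_mul_le_iff₀ (by exact_mod_cast hN)]
    refine (Finset.abs_sum_le_sum_abs _ _).trans
      ((Finset.sum_le_card_nsmul _ _ ε fun j hj => ?_).trans (by simp))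
    rw [abs_mul]
    simpa using mul_le_mul (hφ (z j)) (hk.abs_smoother_sub_le hosc (Finset.mem_range.1 hj) z)
      (abs_nonneg _) zero_le_one
  rw [hsplit, mul_add, mul_add, mul_add]
  rw [Real.dist_eq] at h1 h3
  rw [sub_zero] at h1
  rw [abs_lt] at h1 h3
  rw [abs_le] at hb2 hb3 hIJ ⊢
  constructor <;> linarith [hk.bound_nonneg]

/-- Universal consistency of the average of the Nadaraya–Watson estimates at the design points,
for i.i.d. data on a compact metric space and a bounded response. -/
theorem IsLocalKernel.ae_tendsto_average_smoother (hk : IsLocalKernel k C)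
    [BorelSpace E] [StandardBorelSpace F] [Nonempty F] (ρ : Measure (E × F))
    [IsProbabilityMeasure ρ] {y : F → ℝ} (hy : Measurable y) (hy0 : ∀ l, 0 ≤ y l)
    (hy1 : ∀ l, y l ≤ 1) {φ : E → ℝ}
    (hφm : Measurable φ) (hφ : ∀ u, |φ u| ≤ 1) :
    ∀ᵐ p ∂(Measure.infinitePi fun _ : ℕ => ρ), Tendsto (fun N : ℕ =>
      (N : ℝ)⁻¹ * ∑ j ∈ Finset.range N, φ (p j).1 *
        ((∑ i ∈ Finset.range N, k N (p j).1 (p i).1 * y (p i).2)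
          / ∑ l ∈ Finset.range N, k N (p j).1 (p l).1)) atTop (𝓝 (∫ q, y q.2 * φ q.1 ∂ρ)) := by
  obtain ⟨g, hgm, hg0, hg1, hc⟩ := exists_condCentered ρ hy hy0 hy1
  have hg : ∀ u, |g u| ≤ 1 := fun u => abs_le.2 ⟨by linarith [hg0 u], hg1 u⟩
  have hgint : Integrable g ρ.fst :=
    Integrable.of_bound hgm.aestronglyMeasurable 1 (ae_of_all _ hg)
  -- Countably many approximants suffice, so the exceptional null sets can be united before `ε` is
  -- chosen.
  have hγ := fun n : ℕ => hgint.exists_boundedContinuous_integral_sub_le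
    (show (0 : ℝ) < 1 / ((n : ℝ) + 1) by positivity)
  choose γ hγ _ using hγ
  have hγm : ∀ n, Measurable (γ n) := fun n => (γ n).continuous.measurable
  have hγR : ∀ n, ∫ q, |g q.1 - γ n q.1| ∂ρ ≤ 1 / ((n : ℝ) + 1) := fun n => by
    refine le_of_eq_of_le ?_ (hγ n)
    rw [Measure.fst, integral_map measurable_fst.aemeasurable
      (by have := hγm n; fun_prop : Measurable fun u => ‖g u - γ n u‖).aestronglyMeasurable]
    rfl
  have hgφ : ∫ q, y q.2 * φ q.1 ∂ρ = ∫ q, g q.1 * φ q.1 ∂ρ := by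
    have h := hc φ hφm ⟨1, hφ⟩
    simp only [sub_mul] at h
    rw [integral_sub] at h
    · exact sub_eq_zero.1 h
    · refine Integrable.of_bound (by fun_prop) (1 * 1) (ae_of_all _ fun q => ?_)
      rw [Real.norm_eq_abs, abs_mul]
      exact mul_le_mul (abs_le.2 ⟨by linarith [hy0 q.2], hy1 _⟩) (hφ _) (abs_nonneg _) zero_le_one
    · refine Integrable.of_bound (by fun_prop) (1 * 1) (ae_of_all _ fun q => ?_)
      rw [Real.norm_eq_abs, abs_mul]
      exact mul_le_mul (hg _) (hφ _) (abs_nonneg _) zero_le_one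
  have hγb : ∀ n u, |γ n u| ≤ ‖γ n‖ := fun n u => (γ n).norm_coe_le_norm u
  have hIJ : ∀ n, |∫ q, γ n q.1 * φ q.1 ∂ρ - ∫ q, y q.2 * φ q.1 ∂ρ| ≤ 1 / ((n : ℝ) + 1) :=
    fun n => by
    have := hγm n
    rw [hgφ, ← integral_sub]
    · refine (abs_integral_le_integral_abs).trans ((integral_mono_of_nonneg
        (ae_of_all _ fun q => abs_nonneg _) ?_ (ae_of_all _ fun q => ?_)).trans (hγR n))
      · refine Integrable.of_bound (by fun_prop) (1 + ‖γ n‖) (ae_of_all _ fun q => ?_)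
        rw [Real.norm_eq_abs, abs_abs]
        exact (abs_sub _ _).trans (add_le_add (hg _) (hγb n _))
      · simp only
        rw [← sub_mul, abs_mul, abs_sub_comm]
        exact mul_le_of_le_one_right (abs_nonneg _) (hφ _)
    · refine Integrable.of_bound (by fun_prop) (‖γ n‖ * 1) (ae_of_all _ fun q => ?_)
      rw [Real.norm_eq_abs, abs_mul]
      exact mul_le_mul (hγb n _) (hφ _) (abs_nonneg _) (norm_nonneg _)
    · refine Integrable.of_bound (by fun_prop) (1 * 1) (ae_of_all _ fun q => ?_)
      rw [Real.norm_eq_abs, abs_mul]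
      exact mul_le_mul (hg _) (hφ _) (abs_nonneg _) zero_le_one
  have h1 := ae_tendsto_average_zero (ρ := ρ) (ξ := fun q => y q.2 - g q.1) (by fun_prop)
    (fun q => abs_le.2 ⟨by linarith [hy0 q.2, hg1 q.1], by linarith [hy1 q.2, hg0 q.1]⟩) hc
    (fun N i => hk.measurable_responseWeight hφm N N i)
    (fun N i z => hk.abs_responseWeight_le hφ N N i z)
  have h2 := ae_all_iff.2 fun n : ℕ => ae_tendsto_average ρ (G := fun q => |g q.1 - γ n q.1|)
    (by have := hγm n; fun_prop) (B := 1 + ‖γ n‖) fun q => by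
      rw [abs_abs]; exact (abs_sub _ _).trans (add_le_add (hg _) (hγb n _))
  have h3 := ae_all_iff.2 fun n : ℕ => ae_tendsto_average ρ (G := fun q => γ n q.1 * φ q.1)
    (by have := hγm n; fun_prop) (B := ‖γ n‖ * 1) fun q => by
      rw [abs_mul]; exact mul_le_mul (hγb n _) (hφ _) (abs_nonneg _) (norm_nonneg _)
  filter_upwards [h1, h2, h3] with p h1 h2 h3
  rw [Metric.tendsto_nhds]
  intro ε hε
  have hC : 0 < 2 * C + 4 := by linarith [hk.bound_nonneg]
  obtain ⟨n, hn⟩ := exists_nat_one_div_lt (div_pos hε hC)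
  filter_upwards [hk.eventually_abs_average_sub_le (z := fun j => (p j).1)
    (y := fun j => y (p j).2) hφ (γ n).continuous (by positivity) (hγR n) (hIJ n) h1 (h2 n)
    (h3 n)] with N hN
  rw [Real.dist_eq]
  refine hN.trans_lt ?_
  rw [lt_div_iff₀ hC] at hn
  linarith

end Consistency

end KernelRegression

/-! ### Kernels of a comparable metric on the sphere. -/

namespace SoftLabel

variable {m : ℕ} {K : ℝ → ℝ} {d : Euc m → Euc m → ℝ}

lemma IsKernel.pos_of_lt_one (hK : IsKernel K) {t : ℝ} (h0 : 0 ≤ t) (h1 : t < 1) : 0 < K t :=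
  (hK.nonneg 1 zero_le_one).trans_lt
    (hK.strictAnti ⟨h0, h1.le⟩ ⟨zero_le_one, le_rfl⟩ h1)

lemma IsKernel.le_one_of_ne_zero (hK : IsKernel K) {t : ℝ} (h : K t ≠ 0) : t ≤ 1 :=
  not_lt.1 fun h1 => h (hK.support t h1)

lemma IsKernel.le_zero_value (hK : IsKernel K) {t : ℝ} (h0 : 0 ≤ t) : K t ≤ K 0 := by
  rcases le_or_gt t 1 with h1 | h1
  · exact hK.strictAnti.antitoneOn ⟨le_rfl, zero_le_one⟩ ⟨h0, h1⟩ h0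
  · rw [hK.support t h1]
    exact hK.nonneg 0 le_rfl

/-- `K` is arbitrary on negative numbers, but on `[0,∞)` it agrees with its restriction to `[0,1]`
extended by zero, which is piecewise continuous. -/
lemma IsKernel.measurable_comp (hK : IsKernel K) {X : Type*} [MeasurableSpace X] {r : X → ℝ}
    (hr : Measurable r) (hr0 : ∀ x, 0 ≤ r x) : Measurable fun x => K (r x) := by
  have hcont : ContinuousOn K (Set.Icc 0 1) := hK.differentiable.continuousOn
  have hind : Measurable ((Set.Icc (0 : ℝ) 1).indicator K) := by
    classical
    rw [← Set.piecewise_eq_indicator]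
    exact hcont.measurable_piecewise continuous_zero.continuousOn measurableSet_Icc
  convert hind.comp hr using 1
  ext x
  by_cases h : r x ≤ 1
  · simp [Set.indicator, hr0 x, h]
  · simp [Set.indicator, h, hK.support _ (not_le.1 h)]

/-- By the triangle inequality, moving both arguments changes `d` by at most the sum of the two
displacements, hence the Lipschitz constant `2 * b` for the sup distance on the product. -/
lemma continuous_dist_of_comparable (hd : IsMetric d) (hd_comp : ComparableOnSphere d) :
    Continuous fun x : Sph m × Sph m => d x.1 x.2 := by
  obtain ⟨a, b, _, hb, hab⟩ := hd_comp
  refine (LipschitzWith.of_dist_le_mul (K := Real.toNNReal (2 * b)) fun x y => ?_).continuous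
  have h1 := (hab x.1 y.1).2
  have h2 := (hab x.2 y.2).2
  rw [← dist_eq_norm, ← Subtype.dist_eq] at h1 h2
  have h3 : dist x.1 y.1 ≤ dist x y := le_max_left _ _
  have h4 : dist x.2 y.2 ≤ dist x y := le_max_right _ _
  have h5 := mul_le_mul_of_nonneg_left h3 hb.le
  have h6 := mul_le_mul_of_nonneg_left h4 hb.le
  have t1 := hd.triangle x.1 y.1 x.2
  have t2 := hd.triangle y.1 y.2 x.2
  have t3 := hd.triangle y.1 x.1 y.2
  have t4 := hd.triangle x.1 x.2 y.2
  have s1 := hd.symm y.1 x.1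
  have s2 := hd.symm y.2 x.2
  rw [Real.dist_eq, Real.coe_toNNReal _ (by positivity), abs_le]
  constructor <;> linarith

/-- The rescaled kernels of a metric comparable with the Euclidean one have bounded normalized
weights and concentrate at the diagonal. -/
theorem exists_isLocalKernel (hd : IsMetric d) (hd_comp : ComparableOnSphere d) (hK : IsKernel K)
    {h : ℕ → ℝ} (h_pos : ∀ N, 0 < h N) (h_zero : Tendsto h atTop (𝓝 0)) :
    ∃ C, KernelRegression.IsLocalKernel
      (fun N (u v : Sph m) => scaledKernel K (h N) (d u v)) C := by
  have hcont := continuous_dist_of_comparable hd hd_comp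
  obtain ⟨a, b, ha, hb, hab⟩ := hd_comp
  have hd0 : ∀ u v : Sph m, 0 ≤ d u v := fun u v =>
    (mul_nonneg ha.le (norm_nonneg _)).trans (hab u v).1
  have hdh0 : ∀ N (u v : Sph m), 0 ≤ d u v / h N := fun N u v => div_nonneg (hd0 u v) (h_pos N).le
  have hnear : ∀ N (u v : Sph m), scaledKernel K (h N) (d u v) ≠ 0 → d u v ≤ h N :=
    fun N u v huv => by
    have := hK.le_one_of_ne_zero (right_ne_zero_of_mul huv)
    rwa [div_le_one (h_pos N)] at this
  have hnonneg : ∀ N (u v : Sph m), 0 ≤ scaledKernel K (h N) (d u v) := fun N u v =>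
    mul_nonneg (one_div_pos.2 (h_pos N)).le (hK.nonneg _ (hdh0 N u v))
  -- Strong interaction is measured at `1 / 2`, since `K` may vanish at `1`.
  have hK2 : 0 < K (1 / 2) := hK.pos_of_lt_one (by norm_num) (by norm_num)
  have hK0 : 0 < K 0 := hK.pos_of_lt_one le_rfl zero_lt_one
  -- After rescaling by `1 / h` about `u`, the points interacting with `u` lie in the ball of radius
  -- `1 / a`, so one finite cover serves all `N` and `u`. Two points in the same ball of radius `1 /
  -- (4 * b)` are less than `1 / (2 * b)` apart, hence at `d`-distance at most `h / 2` before
  -- rescaling.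
  obtain ⟨T, -, hTfin, hT⟩ := (isCompact_closedBall (0 : Euc m) (1 / a)).finite_cover_balls
    (show (0 : ℝ) < 1 / (4 * b) by positivity)
  have hcell : ∀ x : Euc m, ∃ t, ‖x‖ ≤ 1 / a → t ∈ T ∧ dist x t < 1 / (4 * b) := fun x => by
    by_cases hx : ‖x‖ ≤ 1 / a
    · have := hT (mem_closedBall_zero_iff.2 hx)
      simp only [Set.mem_iUnion, Metric.mem_ball, exists_prop] at this
      obtain ⟨t, ht⟩ := this
      exact ⟨t, fun _ => ht⟩
    · exact ⟨0, fun hx' => absurd hx' hx⟩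
  choose cell hcell using hcell
  refine ⟨hTfin.toFinset.card * (K 0 / K (1 / 2)), fun N => ?_, hnonneg, fun N u => ?_,
    fun δ hδ => ?_, by positivity, fun N n z u => ?_⟩
  · exact (hK.measurable_comp (hcont.measurable.div_const (h N)) fun x =>
      hdh0 N x.1 x.2).const_mul _
  · rw [scaledKernel, (hd.eq_zero_iff _ _).2 rfl, zero_div]
    have := h_pos N
    positivity
  · filter_upwards [h_zero.eventually_lt_const (show 0 < a * δ by positivity)] with N hN u v huv
    rw [Subtype.dist_eq, dist_eq_norm]
    exact lt_of_mul_lt_mul_left (((hab u v).1.trans (hnear N u v huv)).trans_lt hN) ha.le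
  · have hN := h_pos N
    set x : Sph m → Euc m := fun v => (h N)⁻¹ • ((v : Euc m) - u) with hx
    have hxnorm : ∀ v : Sph m, scaledKernel K (h N) (d v u) ≠ 0 → ‖x v‖ ≤ 1 / a := fun v hv => by
      rw [hx, norm_smul, Real.norm_of_nonneg (inv_pos.2 hN).le, inv_mul_le_iff₀ hN, mul_one_div,
        le_div_iff₀ ha, mul_comm]
      exact (hab v u).1.trans (hnear N v u hv)
    have := KernelRegression.sum_div_sum_le_of_cells
      (k := fun u v : Sph m => scaledKernel K (h N) (d u v)) (hnonneg N) (u := u)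
      hTfin.toFinset (fun v => cell (x v))
      (fun v hv => hTfin.mem_toFinset.2 (hcell _ (hxnorm v hv)).1)
      (α := 1 / h N * K (1 / 2)) (β := 1 / h N * K 0) (by positivity) (by positivity)
      (fun v => mul_le_mul_of_nonneg_left (hK.le_zero_value (hdh0 N v u)) (by positivity))
      (fun v w hv hw hvw => by
        refine mul_le_mul_of_nonneg_left ?_ (by positivity)
        have h1 := (hcell _ (hxnorm v hv)).2
        have h2 := (hcell _ (hxnorm w hw)).2
        rw [← hvw] at h2
        have h3 : dist (x v) (x w) < 1 / (2 * b) :=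
          (dist_triangle_right _ _ _).trans_lt ((add_lt_add h1 h2).trans_eq (by ring))
        have h4 : dist (x v) (x w) = (h N)⁻¹ * ‖(v : Euc m) - w‖ := by
          rw [dist_eq_norm, hx]
          simp only
          rw [← smul_sub, sub_sub_sub_cancel_right, norm_smul,
            Real.norm_of_nonneg (inv_pos.2 hN).le]
        have h5 : d v w / h N ≤ 1 / 2 := by
          rw [h4, lt_div_iff₀ (by positivity)] at h3
          rw [div_le_iff₀ hN]
          rw [inv_mul_eq_div, div_mul_eq_mul_div, div_lt_iff₀ hN] at h3
          linarith [(hab v w).2]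
        exact hK.strictAnti.antitoneOn ⟨hdh0 N v w, h5.trans (by norm_num)⟩
          ⟨by norm_num, by norm_num⟩ h5) n z
    refine this.trans_eq ?_
    field_simp

variable {𝓧 : Type*} [MeasurableSpace 𝓧] {M : ℕ}

/-- Coordinates of the class mean. -/
lemma fBar_apply (ν : Measure (𝓧 × Fin M)) [IsProbabilityMeasure ν] {f : 𝓧 → Sph m}
    (hf : Measurable f) (c : Fin M) (i : Fin m) :
    fBar ν f c i = (ν.real (Prod.snd ⁻¹' {c}))⁻¹ *
      ∫ p, (if p.2 = c then 1 else 0) * (f p.1 : Euc m) i ∂ν := by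
  have hs : MeasurableSet (Prod.snd ⁻¹' {c} : Set (𝓧 × Fin M)) :=
    measurable_snd (measurableSet_singleton c)
  have hint : Integrable (fun p : 𝓧 × Fin M => (f p.1 : Euc m))
      (ProbabilityTheory.cond ν (Prod.snd ⁻¹' {c})) :=
    Integrable.of_bound (by fun_prop : Measurable _).aestronglyMeasurable 1
      (ae_of_all _ fun p => by simp)
  have h1 := (EuclideanSpace.proj (𝕜 := ℝ) i).integral_comp_comm hint
  change ∫ p : 𝓧 × Fin M, (f p.1 : Euc m) i ∂_ = fBar ν f c i at h1
  rw [← h1, ProbabilityTheory.cond, integral_smul_measure, ENNReal.toReal_inv, smul_eq_mul,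
    ← integral_indicator hs]
  congr 1
  refine integral_congr_ae (ae_of_all _ fun p => ?_)
  by_cases hp : p.2 = c <;> simp [Set.indicator, hp]

end SoftLabel

/-! ### Transfer to the sample and passage to the quotient. -/

theorem mainTheorem4
    {Ω : Type*} [MeasurableSpace Ω] (P : Measure Ω) [IsProbabilityMeasure P]
    {𝓧 : Type*} [MeasurableSpace 𝓧] {m M : ℕ}
    -- the joint law of `(X, C)` and an i.i.d. sample from it
    (ν : Measure (𝓧 × Fin M)) [IsProbabilityMeasure ν]
    (D : ℕ → Ω → 𝓧 × Fin M)
    (hD_indep : iIndepFun D P) (hD_law : ∀ i, HasLaw (D i) ν P)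
    -- the encoder
    (f : 𝓧 → SoftLabel.Sph m) (hf : Measurable f)
    -- the metric, the kernel and the class
    (d : SoftLabel.Euc m → SoftLabel.Euc m → ℝ) (hd : SoftLabel.IsMetric d)
    (hd_comp : SoftLabel.ComparableOnSphere d)
    (K : ℝ → ℝ) (hK : SoftLabel.IsKernel K)
    (c : Fin M) (hc : ν (Prod.snd ⁻¹' {c}) ≠ 0)
    -- the bandwidths
    (h : ℕ → ℝ) (h_pos : ∀ N, 0 < h N) (h_zero : Tendsto h atTop (𝓝 0))
    (h_rate : Tendsto (fun N : ℕ => Real.sqrt (Real.log N / (h N ^ m * N))) atTop (𝓝 0))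
    -- the Hölder condition, on the estimates or on the soft label
    (h_holder :
      (∀ᵐ ω ∂P, ∃ C β : ℝ, 0 < β ∧ ∀ᶠ N in atTop,
        SoftLabel.HolderOnSphere d C β fun u =>
          SoftLabel.nadarayaWatson K d (h N) N
            (fun j => (f (D j ω).1 : SoftLabel.Euc m)) (fun j => (D j ω).2) c u) ∨
      (∃ C β : ℝ, 0 < β ∧ ∃ g : SoftLabel.Sph m → ℝ,
        SoftLabel.IsSoftLabel ν f c g ∧ SoftLabel.HolderOnSphere d C β g))
    -- the density condition
    (h_density : SoftLabel.DensityBoundedBelow ν f) :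
    ∀ᵐ ω ∂P, Tendsto
      (fun N : ℕ => SoftLabel.fHat K d (h N) N
        (fun j => (f (D j ω).1 : SoftLabel.Euc m)) (fun j => (D j ω).2) c)
      atTop (𝓝 (SoftLabel.fBar ν f c)) := by
  obtain ⟨B, hk⟩ := SoftLabel.exists_isLocalKernel hd hd_comp hK h_pos h_zero
  have hFin : Nonempty (Fin M) := ⟨c⟩
  set e : 𝓧 × Fin M → SoftLabel.Sph m × Fin M := fun p => (f p.1, p.2) with he
  have hem : Measurable e := by fun_prop
  set ρ := ν.map e with hρ
  have hρprob : IsProbabilityMeasure ρ := Measure.isProbabilityMeasure_map hem.aemeasurable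
  set y : Fin M → ℝ := fun l => if l = c then 1 else 0 with hy
  have hym : Measurable y := Measurable.of_discrete
  have hy0 : ∀ l, 0 ≤ y l := fun l => by simp only [hy]; split_ifs <;> norm_num
  have hy1 : ∀ l, y l ≤ 1 := fun l => by simp only [hy]; split_ifs <;> norm_num
  -- The embedded sample has the infinite product law, so almost sure statements on sequence space
  -- pull back to `P`.
  have hlaw : HasLaw (fun ω i => e (D i ω)) (Measure.infinitePi fun _ : ℕ => ρ) P :=
    iIndepFun.hasLaw_infinitePi
      (fun i => ⟨hem.comp_aemeasurable (hD_law i).aemeasurable, by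
        change P.map (e ∘ D i) = ρ
        rw [← AEMeasurable.map_map_of_aemeasurable hem.aemeasurable (hD_law i).aemeasurable,
          (hD_law i).map_eq]⟩)
      (hD_indep.comp (fun _ => e) fun _ => hem)
      (aemeasurable_pi_lambda _ fun i => hem.comp_aemeasurable (hD_law i).aemeasurable)
  have key : ∀ φ : SoftLabel.Sph m → ℝ, Measurable φ → (∀ u, |φ u| ≤ 1) →
      ∀ᵐ ω ∂P, Tendsto (fun N : ℕ => (N : ℝ)⁻¹ * ∑ j ∈ Finset.range N, φ (f (D j ω).1) *
        SoftLabel.nadarayaWatson K d (h N) N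
          (fun j => (f (D j ω).1 : SoftLabel.Euc m)) (fun j => (D j ω).2) c (f (D j ω).1))
        atTop (𝓝 (∫ p, y p.2 * φ (f p.1) ∂ν)) := fun φ hφm hφ => by
    have h1 := hk.ae_tendsto_average_smoother ρ hym hy0 hy1 hφm hφ
    rw [← hlaw.map_eq] at h1
    have h2 := ae_of_ae_map hlaw.aemeasurable h1
    have h3 : ∫ q, y q.2 * φ q.1 ∂ρ = ∫ p, y p.2 * φ (f p.1) ∂ν := by
      rw [hρ, integral_map hem.aemeasurable (by fun_prop : Measurable _).aestronglyMeasurable]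
    rw [h3] at h2
    exact h2
  have hcoord : ∀ i (u : SoftLabel.Sph m), |(u : SoftLabel.Euc m) i| ≤ 1 := fun i u => by
    have := PiLp.norm_apply_le (u : SoftLabel.Euc m) i
    simpa using this
  have hden := key (fun _ => 1) measurable_const (by simp)
  have hnum := ae_all_iff.2 fun i => key (fun u => (u : SoftLabel.Euc m) i) (by fun_prop) (hcoord i)
  have hmass : ∫ p, y p.2 * (1 : ℝ) ∂ν = ν.real (Prod.snd ⁻¹' {c}) := by
    have hs : MeasurableSet (Prod.snd ⁻¹' {c} : Set (𝓧 × Fin M)) :=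
      measurable_snd (measurableSet_singleton c)
    rw [← integral_indicator_one hs]
    refine integral_congr_ae (ae_of_all _ fun p => ?_)
    by_cases hp : p.2 = c <;> simp [Set.indicator, hy, hp]
  have hmass0 : ν.real (Prod.snd ⁻¹' {c}) ≠ 0 :=
    ENNReal.toReal_ne_zero.2 ⟨hc, measure_ne_top _ _⟩
  filter_upwards [hden, hnum] with ω hden hnum
  rw [hmass] at hden
  rw [(PiLp.homeomorph 2 fun _ : Fin m => ℝ).isInducing.tendsto_nhds_iff, tendsto_pi_nhds]
  intro i
  change Tendsto _ _ (𝓝 (SoftLabel.fBar ν f c i))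
  rw [SoftLabel.fBar_apply ν hf]
  -- The factors `1 / N` in numerator and denominator cancel once `N > 0`.
  refine ((hden.inv₀ hmass0).mul (hnum i)).congr' ?_
  filter_upwards [eventually_gt_atTop 0] with N hN
  have hN' : (N : ℝ) ≠ 0 := by exact_mod_cast hN.ne'
  change _ = SoftLabel.fHat K d (h N) N (fun j => (f (D j ω).1 : SoftLabel.Euc m))
    (fun j => (D j ω).2) c i
  simp only [SoftLabel.fHat, PiLp.smul_apply, WithLp.ofLp_sum, Finset.sum_apply, smul_eq_mul,
    one_mul, mul_inv, inv_inv, mul_comm (SoftLabel.nadarayaWatson _ _ _ _ _ _ _ _)]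
  field_simp
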